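/- Conventions. Let $D$ be an integral domain with quotient field $K$. An overring of $D$ is a subring of $K$ containing $D$; $\mathcal{O}(D)$ denotes the set of overrings of $D$. A ring is quasi-local if it has exactly one maximal ideal, and $\mathcal{O}_{ql}(D)$ denotes the set of quasi-local overrings of $D$. $\mathrm{Max}(D)$ is the set of maximal ideals of $D$, and each localization $D_M$, $M\in\mathrm{Max}(D)$, is regarded as a subring of $K$. An MNI ideal of $D$ is an ideal of $D$ that is maximal among the non-invertible ideals of $D$ (the zero ideal counts as non-invertible). $D$ is an MPD domain if it has a unique MNI ideal $Q$ and every nonzero non-invertible ideal of $D$ can be written as $JQ$ for some invertible ideal $J\subseteq D$. $D$ is h-local if each nonzero ideal is contained in only finitely many maximal ideals and each nonzero prime ideal is contained in a unique maximal ideal. $D$ is a GMPD domain (globalized multiplicatively pinched-Dedekind domain) if $D$ is h-local and $D_M$ is an MPD domain for every $M\in\mathrm{Max}(D)$. Lemma 2.5. Let $D$ be a GMPD domain with $|\mathcal{O}(D)|<\infty$. Then $\mathrm{Max}(D)$ is finite and $$|\mathcal{O}_{ql}(D)|=\sum_{M\in\mathrm{Max}(D)}|\mathcal{O}(D_M)|-|\mathrm{Max}(D)|+1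 .$$ -/

import Mathlib

/-- An ideal `I` of a domain `R` is invertible if it is a unit among the fractional ideals
of `R` in its quotient field. -/
def IsInvertibleIdeal {R : Type*} [CommRing R] (I : Ideal R) : Prop :=
  IsUnit (I : FractionalIdeal (nonZeroDivisors R) (FractionRing R))

/-- An MNI ideal: an ideal which is maximal among the non-invertible ideals. -/
def IsMNI {R : Type*} [CommRing R] (Q : Ideal R) : Prop :=
  Maximal (fun I : Ideal R => ¬ IsInvertibleIdeal I) Q

/-- MPD (multiplicatively pinched-Dedekind) domains: there is a unique MNI ideal `Q`, and every
nonzero non-invertible ideal is a product `J * Q` with `J` an invertible (integral) ideal. -/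
def IsMPD (R : Type*) [CommRing R] : Prop :=
  IsDomain R ∧ ∃ Q : Ideal R, IsMNI Q ∧ (∀ P : Ideal R, IsMNI P → P = Q) ∧
    ∀ I : Ideal R, I ≠ ⊥ → ¬ IsInvertibleIdeal I → ∃ J : Ideal R, IsInvertibleIdeal J ∧ I = J * Q

/-- h-local domains: each nonzero ideal is contained in only finitely many maximal ideals and
each nonzero prime ideal is contained in a unique maximal ideal. -/
def IsHLocal (R : Type*) [CommRing R] : Prop :=
  IsDomain R ∧ (∀ I : Ideal R, I ≠ ⊥ → {M : Ideal R | M.IsMaximal ∧ I ≤ M}.Finite) ∧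
    ∀ P : Ideal R, P.IsPrime → P ≠ ⊥ → ∃! M : Ideal R, M.IsMaximal ∧ P ≤ M

/-- GMPD (globalized multiplicatively pinched-Dedekind) domains: h-local domains all of whose
localizations at maximal ideals are MPD domains. -/
def IsGMPD (R : Type*) [CommRing R] : Prop :=
  IsHLocal R ∧ ∀ (M : Ideal R) [M.IsMaximal], IsMPD (Localization.AtPrime M)

/-- The set `O(R)` of overrings of `R`: the subrings of the quotient field `K` of `R` which
contain (the image of) `R`. -/
def overrings (R K : Type*) [CommRing R] [Field K] [Algebra R K] : Set (Subring K) :=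
  {E | (algebraMap R K).range ≤ E}

/-- The set of quasi-local overrings of `R`, i.e. overrings with exactly one maximal ideal. -/
def quasiLocalOverrings (R K : Type*) [CommRing R] [Field K] [Algebra R K] : Set (Subring K) :=
  {E | E ∈ overrings R K ∧ IsLocalRing E}

/-- The localization `R_M` as a subring of the quotient field `K` of `R`:
the fractions `a / s` with `a ∈ R` and `s ∈ R \ M`. -/
noncomputable def localizationAt {R : Type*} (K : Type*) [CommRing R] [IsDomain R] [Field K]
    [Algebra R K] [IsFractionRing R K] (M : MaximalSpectrum R) : Subalgebra R K :=
  Localization.subalgebra.ofField K M.asIdeal.primeCompl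
    M.asIdeal.primeCompl_le_nonZeroDivisors

/-! An overring `E ≠ K` that is quasi-local contracts its maximal ideal to a nonzero prime `P` of
`D`. By h-locality `P` lies in a single maximal ideal `M`, so `E` contains `D_M` for that `M` only.
Conversely every overring of `D_M` is quasi-local. Away from `K`, the quasi-local overrings are thus
the disjoint union of the sets `O(D_M) \ {K}`, and counting gives the formula.

The converse is the local input. Let `R` be local MPD with maximal ideal `m`. Either `R` is a
valuation domain, or `m` is finitely generated and every non-principal ideal is some `d m`. In the
second case `V = (m : m)` is a valuation ring lying in every overring strictly larger than `R`;
overrings of valuation rings are local. -/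

open IsLocalRing in
/-- The overring `(𝔪 : 𝔪)` of a local ring with maximal ideal `𝔪`. -/
def maximalIdealMultipliers (R K : Type*) [CommRing R] [IsLocalRing R] [Field K] [Algebra R K] :
    Subring K where
  carrier := {z | ∀ y ∈ maximalIdeal R, ∃ w ∈ maximalIdeal R, algebraMap R K w = z * algebraMap R K y}
  mul_mem' := by
    intro a b ha hb y hy
    obtain ⟨w, hw, hw'⟩ := hb y hy
    obtain ⟨v, hv, hv'⟩ := ha w hw
    exact ⟨v, hv, by rw [hv', hw', mul_assoc]⟩
  one_mem' := fun y hy => ⟨y, hy, by simp⟩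
  add_mem' := by
    intro a b ha hb y hy
    obtain ⟨w, hw, hw'⟩ := hb y hy
    obtain ⟨v, hv, hv'⟩ := ha y hy
    exact ⟨v + w, add_mem hv hw, by rw [map_add, hv', hw', add_mul]⟩
  zero_mem' := fun y _ => ⟨0, zero_mem _, by simp⟩
  neg_mem' := by
    intro a ha y hy
    obtain ⟨v, hv, hv'⟩ := ha y hy
    exact ⟨-v, neg_mem hv, by rw [map_neg, hv', neg_mul]⟩

theorem isLocalRing_of_le_of_forall_mem_or_inv_mem {K : Type*} [Field K] {T E : Subring K}
    (hT : ∀ x : K, x ∈ T ∨ x⁻¹ ∈ T) (h : T ≤ E) : IsLocalRing E :=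
  let V : ValuationSubring K := ⟨E, fun x => (hT x).imp (@h x) (@h x⁻¹)⟩
  inferInstanceAs (IsLocalRing V)

theorem not_isInvertibleIdeal_bot {R : Type*} [CommRing R] [IsDomain R] :
    ¬ IsInvertibleIdeal (⊥ : Ideal R) := by
  simp [IsInvertibleIdeal]

theorem isInvertibleIdeal_span_singleton {R : Type*} [CommRing R] [IsDomain R] {c : R}
    (hc : c ≠ 0) : IsInvertibleIdeal (Ideal.span {c}) := by
  have hc' : algebraMap R (FractionRing R) c ≠ 0 := by simpa using hc
  rw [IsInvertibleIdeal, FractionalIdeal.coeIdeal_span_singleton]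
  exact IsUnit.of_mul_eq_one (FractionalIdeal.spanSingleton _ (algebraMap R (FractionRing R) c)⁻¹)
    (by rw [FractionalIdeal.spanSingleton_mul_spanSingleton, mul_inv_cancel₀ hc',
      FractionalIdeal.spanSingleton_one])

theorem IsInvertibleIdeal.mul_iff {R : Type*} [CommRing R] [IsDomain R] {I J : Ideal R} :
    IsInvertibleIdeal (I * J) ↔ IsInvertibleIdeal I ∧ IsInvertibleIdeal J := by
  simp only [IsInvertibleIdeal, FractionalIdeal.coeIdeal_mul, IsUnit.mul_iff]

theorem eq_bot_of_le_maximalIdeal_mul {R : Type*} [CommRing R] [IsLocalRing R]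
    {I : Ideal R} (hI : I.FG) (h : I ≤ IsLocalRing.maximalIdeal R * I) :
    I = ⊥ :=
  Submodule.eq_bot_of_le_smul_of_le_jacobson_bot (IsLocalRing.maximalIdeal R) I hI h
    (IsLocalRing.jacobson_eq_maximalIdeal ⊥ bot_ne_top).ge

theorem fg_of_fg_span_singleton_mul {R : Type*} [CommRing R] [IsDomain R] {d : R} {I : Ideal R}
    (hd : d ≠ 0) (h : (Ideal.span {d} * I).FG) : I.FG := by
  have : Ideal.span {d} * I = Submodule.map (LinearMap.mulLeft R d) I := by
    ext x; simp [Ideal.mem_span_singleton_mul]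
  rw [this] at h
  exact Submodule.fg_of_fg_map_injective _ (mul_right_injective₀ hd) h

theorem ne_bot_of_not_isPrincipal {R : Type*} [CommRing R] {I : Ideal R}
    (h : ¬ I.IsPrincipal) : I ≠ ⊥ := by
  rintro rfl; exact h inferInstance

/-! ### Overrings of a local MPD domain -/

section Local

open IsLocalRing

variable {R K : Type*} [CommRing R] [IsDomain R] [IsLocalRing R] [Field K] [Algebra R K]
  [IsFractionRing R K]

theorem isInvertibleIdeal_iff_isPrincipal {I : Ideal R} (hI : I ≠ ⊥) :
    IsInvertibleIdeal I ↔ I.IsPrincipal := by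
  constructor
  · intro h
    refine Ideal.IsPrincipal.of_finite_maximals_of_isUnit ?_ h
    refine (Set.finite_singleton (maximalIdeal R)).subset fun M hM => ?_
    exact IsLocalRing.eq_maximalIdeal hM
  · rintro ⟨c, rfl⟩
    exact isInvertibleIdeal_span_singleton (by rintro rfl; simp at hI)

theorem dvd_or_dvd_of_isPrincipal_span_pair {a b : R}
    (h : (Ideal.span {a, b}).IsPrincipal) : a ∣ b ∨ b ∣ a := by
  obtain ⟨c, hc⟩ := h
  have hc : Ideal.span {a, b} = Ideal.span {c} := hc
  have ha : c ∣ a := by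
    rw [← Ideal.mem_span_singleton, ← hc]; exact Ideal.subset_span (by simp)
  have hb : c ∣ b := by
    rw [← Ideal.mem_span_singleton, ← hc]; exact Ideal.subset_span (by simp)
  have hcm : c ∈ Ideal.span {a, b} := by rw [hc]; exact Ideal.mem_span_singleton_self c
  obtain ⟨r, s, hrs⟩ := Ideal.mem_span_pair.1 hcm
  obtain ⟨a', rfl⟩ := ha
  obtain ⟨b', rfl⟩ := hb
  by_cases h0 : c = 0
  · subst h0; simp
  have h1 : r * a' + s * b' = 1 := mul_left_cancel₀ h0 (by linear_combination hrs)
  rcases IsLocalRing.isUnit_or_isUnit_of_add_one h1 with h | h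
  · exact Or.inl (mul_dvd_mul_left c (isUnit_of_mul_isUnit_right h).dvd)
  · exact Or.inr (mul_dvd_mul_left c (isUnit_of_mul_isUnit_right h).dvd)

/-- A local MPD domain is either a valuation domain, or its maximal ideal is finitely generated
and non-principal, and every non-principal ideal is a multiple of it. -/
theorem IsMPD.isPrincipal_span_pair_or (hR : IsMPD R) :
    (∀ a b : R, (Ideal.span {a, b}).IsPrincipal) ∨
    ((maximalIdeal R).FG ∧ ¬ (maximalIdeal R).IsPrincipal ∧
      ∀ I : Ideal R, ¬ I.IsPrincipal → ∃ d : R, I = Ideal.span {d} * maximalIdeal R) := by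
  rw [or_iff_not_imp_left]
  intro hv
  push Not at hv
  obtain ⟨a, b, hab⟩ := hv
  obtain ⟨-, Q, hQ, -, hR⟩ := hR
  have key : ∀ I : Ideal R, ¬ I.IsPrincipal → ∃ d : R, I = Ideal.span {d} * Q := by
    intro I hI
    have hI0 := ne_bot_of_not_isPrincipal hI
    obtain ⟨J, hJ, hJQ⟩ := hR I hI0 (by rwa [isInvertibleIdeal_iff_isPrincipal hI0])
    have hJ0 : J ≠ ⊥ := by rintro rfl; exact not_isInvertibleIdeal_bot hJ
    obtain ⟨d, rfl⟩ := (isInvertibleIdeal_iff_isPrincipal hJ0).1 hJ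
    exact ⟨d, hJQ⟩
  obtain ⟨d, hd⟩ := key _ hab
  have h0 := ne_bot_of_not_isPrincipal hab
  have hQ0 : Q ≠ ⊥ := by rintro rfl; simp [hd] at h0
  have hd0 : d ≠ 0 := by rintro rfl; simp [hd] at h0
  -- `d Q` is generated by `a` and `b`, and multiplication by `d` is injective.
  have hQfg : Q.FG := fg_of_fg_span_singleton_mul hd0 (hd ▸ Submodule.fg_span (by simp))
  have hQtop : Q ≠ ⊤ := by
    rintro rfl
    exact hQ.1 ((isInvertibleIdeal_iff_isPrincipal hQ0).2 inferInstance)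
  -- If `Q < m`, maximality of `Q` makes `m = (g)`. Then `Q = g Q'` with `Q ≤ Q'` non-invertible, so
  -- `Q' = Q = m Q` and Nakayama gives `Q = 0`.
  have hQm : Q = maximalIdeal R := by
    by_contra hne
    have hlt : Q < maximalIdeal R := lt_of_le_of_ne (le_maximalIdeal hQtop) hne
    have hm : IsInvertibleIdeal (maximalIdeal R) := by
      by_contra h; exact hQ.not_prop_of_gt hlt h
    obtain ⟨g, hg⟩ := (isInvertibleIdeal_iff_isPrincipal (ne_bot_of_gt hlt)).1 hm
    have hg : maximalIdeal R = Ideal.span {g} := hg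
    obtain ⟨Q', hQ'⟩ : Ideal.span {g} ∣ Q := by
      refine ⟨Submodule.comap (LinearMap.mulLeft R g) Q, ?_⟩
      ext x
      rw [Ideal.mem_span_singleton_mul]
      constructor
      · intro hx
        obtain ⟨z, rfl⟩ := Ideal.mem_span_singleton.1 (hg ▸ hlt.le hx)
        exact ⟨z, hx, rfl⟩
      · rintro ⟨z, hz, rfl⟩; exact hz
    have hle : Q ≤ Q' := hQ'.le.trans Ideal.mul_le_right
    have hninv : ¬ IsInvertibleIdeal Q' := fun h =>
      hQ.1 (hQ' ▸ IsInvertibleIdeal.mul_iff.2 ⟨hg ▸ hm, h⟩)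
    have hQQ : Q' = Q := (hQ.eq_of_le hninv hle).symm
    exact hQ0 (eq_bot_of_le_maximalIdeal_mul hQfg (by rw [hg]; exact (hQQ ▸ hQ').le))
  subst hQm
  exact ⟨hQfg, fun h => hQ.1 ((isInvertibleIdeal_iff_isPrincipal hQ0).2 h), key⟩

section

variable (hfg : (maximalIdeal R).FG) (hnp : ¬ (maximalIdeal R).IsPrincipal)
  (H : ∀ I : Ideal R, ¬ I.IsPrincipal → ∃ d : R, I = Ideal.span {d} * maximalIdeal R)

include hfg hnp in
theorem not_le_span_singleton_mul_mul {d : R} (hd : d ≠ 0) :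
    ¬ Ideal.span {d} * maximalIdeal R ≤ Ideal.span {d} * (maximalIdeal R * maximalIdeal R) := by
  intro h
  exact ne_bot_of_not_isPrincipal hnp
    (eq_bot_of_le_maximalIdeal_mul hfg ((Ideal.span_singleton_mul_right_mono hd).1 h))

include hfg hnp H in
-- `m²` cannot be invertible, since its factor `m` is not. A unit `t` would give `m² = m`, against
-- Nakayama.
theorem exists_maximalIdeal_mul_self_eq :
    ∃ t ∈ maximalIdeal R, t ≠ 0 ∧
      maximalIdeal R * maximalIdeal R = Ideal.span {t} * maximalIdeal R := by
  have hm0 := ne_bot_of_not_isPrincipal hnp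
  have hmm0 : maximalIdeal R * maximalIdeal R ≠ ⊥ := by simpa using hm0
  obtain ⟨t, ht⟩ := H (maximalIdeal R * maximalIdeal R) (by
    rw [← isInvertibleIdeal_iff_isPrincipal hmm0, IsInvertibleIdeal.mul_iff,
      isInvertibleIdeal_iff_isPrincipal hm0]
    tauto)
  have ht0 : t ≠ 0 := by rintro rfl; simp [ht] at hmm0
  refine ⟨t, ?_, ht0, ht⟩
  by_contra htm
  have htu : IsUnit t := by simpa using htm
  rw [Ideal.span_singleton_eq_top.2 htu, Ideal.top_mul] at ht
  exact hm0 (eq_bot_of_le_maximalIdeal_mul hfg ht.ge)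

omit [IsDomain R] [IsFractionRing R K] in
theorem mul_algebraMap_inv_mem_maximalIdealMultipliers [FaithfulSMul R K] {t y : R} (ht0 : t ≠ 0)
    (ht : maximalIdeal R * maximalIdeal R = Ideal.span {t} * maximalIdeal R)
    (hy : y ∈ maximalIdeal R) :
    algebraMap R K y * (algebraMap R K t)⁻¹ ∈ maximalIdealMultipliers R K := by
  have ht0' : algebraMap R K t ≠ 0 := by simpa using ht0
  intro z hz
  have : y * z ∈ Ideal.span {t} * maximalIdeal R := ht ▸ Ideal.mul_mem_mul hy hz
  obtain ⟨w, hw, hw'⟩ := Ideal.mem_span_singleton_mul.1 this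
  refine ⟨w, hw, ?_⟩
  have := congrArg (algebraMap R K) hw'
  simp only [map_mul] at this
  field_simp
  linear_combination this

include hfg hnp H in
-- This says that the nonunits of `V` lie in `m`. For `z ≠ 0` the ideal `z m` is non-principal, so
-- `z m = d m`. If `d` is a unit, `z⁻¹` preserves `m`; otherwise `z t = d y` with `y ∈ m`, and `z =
-- (y / t) d` lies in `V m = m`.
theorem inv_mem_maximalIdealMultipliers_or {z : K} (hz : z ∈ maximalIdealMultipliers R K) :
    z⁻¹ ∈ maximalIdealMultipliers R K ∨ ∃ w ∈ maximalIdeal R, algebraMap R K w = z := by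
  obtain ⟨t, htm, ht0, ht⟩ := exists_maximalIdeal_mul_self_eq hfg hnp H
  have ht0' : algebraMap R K t ≠ 0 := by simpa using ht0
  by_cases hz0 : z = 0
  · subst hz0; exact Or.inl (by simp)
  let I : Ideal R :=
    { carrier := {r | ∃ y ∈ maximalIdeal R, algebraMap R K r = z * algebraMap R K y}
      add_mem' := by
        rintro r s ⟨y, hy, hr⟩ ⟨y', hy', hs⟩
        exact ⟨y + y', add_mem hy hy', by rw [map_add, map_add, hr, hs, mul_add]⟩
      zero_mem' := ⟨0, zero_mem _, by simp⟩
      smul_mem' := by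
        rintro c r ⟨y, hy, hr⟩
        exact ⟨c * y, Ideal.mul_mem_left _ c hy, by
          rw [smul_eq_mul, map_mul, map_mul, hr]; ring⟩ }
  have hI : ¬ I.IsPrincipal := by
    rintro ⟨r, hr⟩
    have hr : I = Ideal.span {r} := hr
    obtain ⟨y₀, hy₀, hry₀⟩ : r ∈ I := hr ▸ Ideal.mem_span_singleton_self r
    refine hnp ⟨y₀, le_antisymm (fun y hy => ?_) ((Ideal.span_singleton_le_iff_mem _).2 hy₀)⟩
    obtain ⟨w, hw, hw'⟩ := hz y hy
    have : w ∈ I := ⟨y, hy, hw'⟩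
    obtain ⟨s, rfl⟩ := Ideal.mem_span_singleton.1 (hr ▸ this)
    refine Ideal.mem_span_singleton.2 ⟨s, ?_⟩
    apply IsFractionRing.injective R K
    apply mul_left_cancel₀ hz0
    rw [← hw', map_mul, map_mul, hry₀]; ring
  obtain ⟨d, hd⟩ := H I hI
  by_cases hdu : IsUnit d
  · left
    rw [Ideal.span_singleton_eq_top.2 hdu, Ideal.top_mul] at hd
    intro y hy
    obtain ⟨w, hw, hw'⟩ : y ∈ I := hd ▸ hy
    exact ⟨w, hw, by rw [hw']; field_simp⟩
  · right
    have hdm : d ∈ maximalIdeal R := hdu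
    obtain ⟨w, hw, hw'⟩ := hz t htm
    have : w ∈ Ideal.span {d} * maximalIdeal R := hd ▸ (⟨t, htm, hw'⟩ : w ∈ I)
    obtain ⟨y, hy, rfl⟩ := Ideal.mem_span_singleton_mul.1 this
    obtain ⟨v, hv, hv'⟩ := mul_algebraMap_inv_mem_maximalIdealMultipliers (K := K) ht0 ht hy d hdm
    refine ⟨v, hv, ?_⟩
    rw [hv']
    rw [map_mul] at hw'
    field_simp
    linear_combination hw'

include hfg hnp H in
theorem mem_or_inv_mem_maximalIdealMultipliers (x : K) :
    x ∈ maximalIdealMultipliers R K ∨ x⁻¹ ∈ maximalIdealMultipliers R K := by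
  obtain ⟨t, -, ht0, ht⟩ := exists_maximalIdeal_mul_self_eq hfg hnp H
  have ht0' : algebraMap R K t ≠ 0 := by simpa using ht0
  have hR : ∀ r : R, algebraMap R K r ∈ maximalIdealMultipliers R K := fun r y hy =>
    ⟨r * y, Ideal.mul_mem_left _ r hy, by simp⟩
  obtain ⟨a, b, hb, rfl⟩ := IsFractionRing.div_surjective R x
  have hb0 : b ≠ 0 := nonZeroDivisors.ne_zero hb
  by_cases ha0 : a = 0
  · subst ha0; left; simp
  have ha0' : algebraMap R K a ≠ 0 := by simpa using ha0
  have hb0' : algebraMap R K b ≠ 0 := by simpa using hb0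
  by_cases hp : (Ideal.span {a, b}).IsPrincipal
  · rcases dvd_or_dvd_of_isPrincipal_span_pair hp with ⟨c, rfl⟩ | ⟨c, rfl⟩
    · right
      rw [map_mul, inv_div, mul_div_cancel_left₀ _ ha0']
      exact hR c
    · left
      rw [map_mul, mul_div_cancel_left₀ _ hb0']
      exact hR c
  · obtain ⟨d, hd⟩ := H _ hp
    have hd0 : d ≠ 0 := by
      rintro rfl
      exact ne_bot_of_not_isPrincipal hp (by simp [hd])
    have hd0' : algebraMap R K d ≠ 0 := by simpa using hd0
    obtain ⟨u, hu, rfl⟩ := Ideal.mem_span_singleton_mul.1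
      (hd ▸ Ideal.subset_span (by simp) : a ∈ Ideal.span {d} * maximalIdeal R)
    obtain ⟨v, hv, rfl⟩ := Ideal.mem_span_singleton_mul.1
      (hd ▸ Ideal.subset_span (by simp) : b ∈ Ideal.span {d} * maximalIdeal R)
    have hu0' : algebraMap R K u ≠ 0 := by simp only [map_mul] at ha0'; exact right_ne_zero_of_mul ha0'
    have hv0' : algebraMap R K v ≠ 0 := by simp only [map_mul] at hb0'; exact right_ne_zero_of_mul hb0'
    have hut := mul_algebraMap_inv_mem_maximalIdealMultipliers (K := K) ht0 ht hu
    have hvt := mul_algebraMap_inv_mem_maximalIdealMultipliers (K := K) ht0 ht hv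
    rcases inv_mem_maximalIdealMultipliers_or hfg hnp H hut with h | ⟨u', hu', hu''⟩
    · right
      convert mul_mem h hvt using 1
      simp only [map_mul]
      field_simp
    rcases inv_mem_maximalIdealMultipliers_or hfg hnp H hvt with h | ⟨v', hv', hv''⟩
    · left
      convert mul_mem h hut using 1
      simp only [map_mul]
      field_simp
    -- Now `u, v ∈ t m`, so `d m = (a, b) ≤ d t m = d m²`, which Nakayama excludes.
    exfalso
    apply not_le_span_singleton_mul_mul hfg hnp hd0
    rw [← hd, Ideal.span_le, ht]
    have aux : ∀ u u' : R, u' ∈ maximalIdeal R →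
        algebraMap R K u' = algebraMap R K u * (algebraMap R K t)⁻¹ →
        d * u ∈ Ideal.span {d} * (Ideal.span {t} * maximalIdeal R) := by
      intro u u' hu' h
      have : u = t * u' := by
        apply IsFractionRing.injective R K
        rw [map_mul, h]; field_simp
      rw [this]
      exact Ideal.mul_mem_mul (Ideal.mem_span_singleton_self d)
        (Ideal.mul_mem_mul (Ideal.mem_span_singleton_self t) hu')
    rintro _ (rfl | rfl)
    · exact aux u u' hu' hu''
    · exact aux v v' hv' hv''

include H in
theorem maximalIdealMultipliers_le {E : Subring K} (hE : (algebraMap R K).range < E) :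
    maximalIdealMultipliers R K ≤ E := by
  have hR : ∀ r : R, algebraMap R K r ∈ E := fun r => hE.le ⟨r, rfl⟩
  obtain ⟨x, hxE, hxR⟩ := SetLike.exists_of_lt hE
  obtain ⟨b, a, ha, rfl⟩ := IsFractionRing.div_surjective R x
  have ha0 : a ≠ 0 := nonZeroDivisors.ne_zero ha
  have ha0' : algebraMap R K a ≠ 0 := by simpa using ha0
  intro z hz
  by_cases hp : (Ideal.span {a, b}).IsPrincipal
  · rcases dvd_or_dvd_of_isPrincipal_span_pair hp with ⟨c, rfl⟩ | ⟨c, rfl⟩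
    · exact absurd ⟨c, by rw [map_mul, mul_div_cancel_left₀ _ ha0']⟩ hxR
    · have hc0' := ha0'
      rw [map_mul] at hc0'
      have hb0' := left_ne_zero_of_mul hc0'
      replace hc0' := right_ne_zero_of_mul hc0'
      -- Here `x = 1 / c`, so `z = (z c) x` with `z c ∈ R`.
      have hc : c ∈ maximalIdeal R := by
        rw [mem_maximalIdeal, mem_nonunits_iff]
        intro hc
        obtain ⟨e, he⟩ := hc.exists_right_inv
        refine hxR ⟨e, ?_⟩
        have := congrArg (algebraMap R K) he
        rw [map_mul, map_one] at this
        rw [map_mul]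
        field_simp
        linear_combination this
      obtain ⟨w, -, hw⟩ := hz c hc
      convert mul_mem (hR w) hxE using 1
      rw [hw, map_mul]
      field_simp
  · obtain ⟨d, hd⟩ := H _ hp
    obtain ⟨u, hu, rfl⟩ := Ideal.mem_span_singleton_mul.1
      (hd ▸ Ideal.subset_span (by simp) : a ∈ Ideal.span {d} * maximalIdeal R)
    obtain ⟨w, hw, hw'⟩ := hz u hu
    -- Since `z a = d w` lies in `d m = (a, b)`, dividing `z a = r a + s b` by `a` gives `z = r + s
    -- x`.
    have : d * w ∈ Ideal.span {d * u, b} :=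
      hd ▸ Ideal.mul_mem_mul (Ideal.mem_span_singleton_self d) hw
    obtain ⟨r, s, hrs⟩ := Ideal.mem_span_pair.1 this
    convert add_mem (hR r) (mul_mem (hR s) hxE) using 1
    have := congrArg (algebraMap R K) hrs
    simp only [map_add, map_mul] at this ha0' ⊢
    rw [hw'] at this
    apply mul_right_cancel₀ ha0'
    rw [add_mul, mul_assoc (algebraMap R K s), div_mul_cancel₀ _ ha0', this]
    ring

end

/-- Every overring of a local MPD domain is local. -/
theorem IsMPD.isLocalRing_of_mem_overrings (hR : IsMPD R) {E : Subring K}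
    (hE : E ∈ overrings R K) : IsLocalRing E := by
  have hE : (algebraMap R K).range ≤ E := hE
  rcases hR.isPrincipal_span_pair_or with h | ⟨hfg, hnp, H⟩
  · refine isLocalRing_of_le_of_forall_mem_or_inv_mem (fun x => ?_) hE
    obtain ⟨a, b, hb, rfl⟩ := IsFractionRing.div_surjective R x
    by_cases ha0 : algebraMap R K a = 0
    · left; rw [ha0, zero_div]; exact zero_mem _
    have hb0' : algebraMap R K b ≠ 0 := by simpa using nonZeroDivisors.ne_zero hb
    rcases dvd_or_dvd_of_isPrincipal_span_pair (h a b) with ⟨c, rfl⟩ | ⟨c, rfl⟩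
    · exact Or.inr ⟨c, by rw [map_mul, inv_div, mul_div_cancel_left₀ _ ha0]⟩
    · exact Or.inl ⟨c, by rw [map_mul, mul_div_cancel_left₀ _ hb0']⟩
  · rcases hE.eq_or_lt with rfl | hlt
    · exact IsLocalRing.of_surjective' (algebraMap R K).rangeRestrict
        (algebraMap R K).rangeRestrict_surjective
    · exact isLocalRing_of_le_of_forall_mem_or_inv_mem
        (mem_or_inv_mem_maximalIdealMultipliers hfg hnp H)
        (maximalIdealMultipliers_le H hlt)

end Local
-- Quasi-local overrings of a GMPD domain
section Global

variable {D K : Type*} [CommRing D] [IsDomain D] [Field K] [Algebra D K] [IsFractionRing D K]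

theorem mem_localizationAt {M : MaximalSpectrum D} {x : K} :
    x ∈ localizationAt K M ↔
      ∃ a s : D, ∃ _ : s ∉ M.asIdeal, x = algebraMap D K a * (algebraMap D K s)⁻¹ :=
  Iff.rfl

theorem mem_overrings_localizationAt_iff {M : MaximalSpectrum D} {E : Subring K} :
    E ∈ overrings (localizationAt K M) K ↔
      E ∈ overrings D K ∧ ∀ s ∉ M.asIdeal, (algebraMap D K s)⁻¹ ∈ E := by
  constructor
  · intro h
    have h : ∀ x ∈ localizationAt K M, x ∈ E := fun x hx => h ⟨⟨x, hx⟩, rfl⟩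
    refine ⟨?_, fun s hs => h _ (mem_localizationAt.2 ⟨1, s, hs, by simp⟩)⟩
    rintro _ ⟨r, rfl⟩
    exact h _ (Subalgebra.algebraMap_mem _ r)
  · rintro ⟨h, hM⟩ _ ⟨⟨x, hx⟩, rfl⟩
    obtain ⟨a, s, hs, rfl⟩ := mem_localizationAt.1 hx
    exact mul_mem (h ⟨a, rfl⟩) (hM s hs)

theorem isLocalRing_of_mem_overrings_localizationAt {M : MaximalSpectrum D}
    (hM : IsMPD (Localization.AtPrime M.asIdeal)) {E : Subring K}
    (hE : E ∈ overrings (localizationAt K M) K) : IsLocalRing E := by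
  -- The MPD hypothesis concerns the abstract localization; `f` carries it into its copy inside `K`.
  let f := Localization.mapToFractionRing K M.asIdeal.primeCompl
    (Localization.AtPrime M.asIdeal) M.asIdeal.primeCompl_le_nonZeroDivisors
  let : Algebra (Localization.AtPrime M.asIdeal) K := f.toRingHom.toAlgebra
  have : IsScalarTower D (Localization.AtPrime M.asIdeal) K :=
    IsScalarTower.of_algebraMap_eq fun x => (f.commutes x).symm
  have : IsDomain (Localization.AtPrime M.asIdeal) := hM.1
  have : IsFractionRing (Localization.AtPrime M.asIdeal) K :=
    IsFractionRing.isFractionRing_of_isDomain_of_isLocalization M.asIdeal.primeCompl _ _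
  refine hM.isLocalRing_of_mem_overrings (K := K) ?_
  rintro _ ⟨x, rfl⟩
  exact hE ⟨⟨f x, mem_localizationAt.2 <|
    (Localization.subalgebra.mem_range_mapToFractionRing_iff_ofField K M.asIdeal.primeCompl
      M.asIdeal.primeCompl_le_nonZeroDivisors (Localization.AtPrime M.asIdeal) (f x)).1
      ⟨x, rfl⟩⟩, rfl⟩

/-- An `s ∈ N \ M` is inverted in `D_M` but not in `D_N`. This makes `Max(D)` finite. -/
theorem localizationAt_toSubring_injective :
    Function.Injective fun M : MaximalSpectrum D => (localizationAt K M).toSubring := by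
  intro M N h
  have h : (localizationAt K M).toSubring = (localizationAt K N).toSubring := h
  by_contra hne
  obtain ⟨s, hsN, hsM⟩ : ∃ s ∈ N.asIdeal, s ∉ M.asIdeal := by
    by_contra! hle
    exact hne (MaximalSpectrum.ext (N.isMaximal.eq_of_le M.isMaximal.ne_top hle).symm)
  have : (algebraMap D K s)⁻¹ ∈ (localizationAt K N).toSubring :=
    h ▸ (mem_localizationAt.2 ⟨1, s, hsM, by simp⟩ : (algebraMap D K s)⁻¹ ∈ localizationAt K M)
  obtain ⟨a, b, hb, hab⟩ := mem_localizationAt.1 this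
  have hs0 : algebraMap D K s ≠ 0 := by
    have : s ≠ 0 := by rintro rfl; exact hsM (zero_mem _)
    simpa using this
  have hb0 : algebraMap D K b ≠ 0 := by
    have : b ≠ 0 := by rintro rfl; exact hb (zero_mem _)
    simpa using this
  have hbs : b = a * s := by
    apply IsFractionRing.injective D K
    field_simp at hab
    rw [map_mul]
    linear_combination hab
  exact hb (hbs ▸ Ideal.mul_mem_left _ a hsN)

omit [IsDomain D] in
/-- The contraction to `D` of the maximal ideal of a local overring `E ≠ K` is nonzero. -/
theorem exists_isPrime_of_mem_quasiLocalOverrings {E : Subring K}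
    (hE : E ∈ quasiLocalOverrings D K) (hE' : E ≠ ⊤) :
    ∃ P : Ideal D, P.IsPrime ∧ P ≠ ⊥ ∧ ∀ s : D, s ∉ P ↔ s ≠ 0 ∧ (algebraMap D K s)⁻¹ ∈ E := by
  obtain ⟨hDE, hloc⟩ := hE
  have hDE : (algebraMap D K).range ≤ E := hDE
  let φ : D →+* E := (Subring.inclusion hDE).comp (algebraMap D K).rangeRestrict
  have hφ : ∀ s, (φ s : K) = algebraMap D K s := fun s => rfl
  let P := (IsLocalRing.maximalIdeal E).comap φ
  have hP : ∀ s : D, s ∉ P ↔ s ≠ 0 ∧ (algebraMap D K s)⁻¹ ∈ E := by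
    intro s
    have h1 : s ∉ P ↔ IsUnit (φ s) := by simp [P]
    rw [h1]
    constructor
    · intro h
      obtain ⟨e, he⟩ := h.exists_right_inv
      have he' : algebraMap D K s * e = 1 := by rw [← hφ]; exact congrArg Subtype.val he
      refine ⟨?_, ?_⟩
      · rintro rfl; simp at he'
      · rw [inv_eq_of_mul_eq_one_right he']; exact e.2
    · rintro ⟨h0, h⟩
      have h0' : algebraMap D K s ≠ 0 := by simpa using h0
      exact IsUnit.of_mul_eq_one ⟨_, h⟩ (Subtype.ext (mul_inv_cancel₀ h0'))
  refine ⟨P, inferInstance, ?_, hP⟩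
  -- If `P = 0`, all nonzero elements of `D` are inverted in `E`, forcing `E = K`.
  intro h0
  apply hE'
  rw [eq_top_iff]
  rintro x -
  obtain ⟨a, b, hb, rfl⟩ := IsFractionRing.div_surjective D x
  rw [div_eq_mul_inv]
  refine mul_mem (hDE ⟨a, rfl⟩) ((hP b).1 ?_).2
  rw [h0]
  have := (algebraMap D K).domain_nontrivial
  exact nonZeroDivisors.ne_zero hb

theorem pairwise_disjoint_overrings_localizationAt_diff_top (hD : IsGMPD D) :
    Pairwise (Function.onFun Disjoint
      fun M : MaximalSpectrum D => overrings (localizationAt K M) K \ {⊤}) := by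
  intro M N hMN
  rw [Function.onFun, Set.disjoint_left]
  rintro E ⟨hM, hE⟩ ⟨hN, -⟩
  apply hMN
  have hloc := isLocalRing_of_mem_overrings_localizationAt (hD.2 M.asIdeal) hM
  rw [mem_overrings_localizationAt_iff] at hM hN
  obtain ⟨P, hP, hP0, hPE⟩ := exists_isPrime_of_mem_quasiLocalOverrings ⟨hM.1, hloc⟩ hE
  have hle : ∀ N : MaximalSpectrum D, (∀ s ∉ N.asIdeal, (algebraMap D K s)⁻¹ ∈ E) →
      P ≤ N.asIdeal := by
    intro N hN s hs
    by_contra hsN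
    exact (hPE s).2 ⟨by rintro rfl; exact hsN (zero_mem _), hN s hsN⟩ hs
  exact MaximalSpectrum.ext ((hD.1.2.2 P hP hP0).unique ⟨M.isMaximal, hle M hM.2⟩
    ⟨N.isMaximal, hle N hN.2⟩)

theorem quasiLocalOverrings_diff_top (hD : IsGMPD D) :
    quasiLocalOverrings D K \ {⊤} =
      ⋃ M : MaximalSpectrum D, overrings (localizationAt K M) K \ {⊤} := by
  ext E
  simp only [Set.mem_iUnion, Set.mem_sdiff]
  constructor
  · rintro ⟨hE, hE'⟩
    obtain ⟨P, hP, -, hPE⟩ := exists_isPrime_of_mem_quasiLocalOverrings hE hE'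
    obtain ⟨M, hM, hPM⟩ := Ideal.exists_le_maximal P hP.ne_top
    exact ⟨⟨M, hM⟩, mem_overrings_localizationAt_iff.2
      ⟨hE.1, fun s hs => ((hPE s).1 fun h => hs (hPM h)).2⟩, hE'⟩
  · rintro ⟨M, hE, hE'⟩
    exact ⟨⟨(mem_overrings_localizationAt_iff.1 hE).1,
      isLocalRing_of_mem_overrings_localizationAt (hD.2 M.asIdeal) hE⟩, hE'⟩

end Global

/-- The finiteness of `Max(D)` is stated as a conjunct, so that the sum and the cardinality of
`Max(D)` are not degenerate; the equation is one of integers. -/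
theorem lemma2p5 {D K : Type*} [CommRing D] [IsDomain D] [Field K] [Algebra D K]
    [IsFractionRing D K] (hD : IsGMPD D) (hfin : (overrings D K).Finite) :
    Finite (MaximalSpectrum D) ∧
      ((quasiLocalOverrings D K).ncard : ℤ) =
        (∑ᶠ M : MaximalSpectrum D, ((overrings (localizationAt K M) K).ncard : ℤ))
          - (Nat.card (MaximalSpectrum D) : ℤ) + 1 := by
  have hsub (M : MaximalSpectrum D) : overrings (localizationAt K M) K ⊆ overrings D K :=
    fun E hE => (mem_overrings_localizationAt_iff.1 hE).1
  have hfinite : Finite (MaximalSpectrum D) := by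
    have : Finite (overrings D K) := hfin
    refine Finite.of_injective (β := overrings D K)
      (fun M => ⟨(localizationAt K M).toSubring, ?_⟩)
      fun M N h => localizationAt_toSubring_injective (congrArg Subtype.val h)
    rintro _ ⟨r, rfl⟩
    exact Subalgebra.algebraMap_mem _ r
  have hql : (⊤ : Subring K) ∈ quasiLocalOverrings D K :=
    ⟨(le_top : (algebraMap D K).range ≤ ⊤),
      isLocalRing_of_le_of_forall_mem_or_inv_mem (T := ⊤) (fun _ => Or.inl trivial) le_rfl⟩
  have hqlfin : (quasiLocalOverrings D K).Finite := hfin.subset fun E hE => hE.1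
  -- `K` lies in every `O(D_M)` but counts once on the left, whence `- |Max(D)| + 1`.
  have hcard (M : MaximalSpectrum D) : ((overrings (localizationAt K M) K).ncard : ℤ) =
      ((overrings (localizationAt K M) K \ {⊤}).ncard : ℤ) + 1 := by
    rw [← Set.ncard_sdiff_singleton_add_one (a := ⊤) _ (hfin.subset (hsub M))]
    · push_cast; rfl
    · exact (le_top : (algebraMap (localizationAt K M) K).range ≤ ⊤)
  refine ⟨hfinite, ?_⟩
  rw [← Set.ncard_sdiff_singleton_add_one hql hqlfin, quasiLocalOverrings_diff_top hD,
    Set.ncard_iUnion_of_finite (fun M => (hfin.subset (hsub M)).sdiff)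
      (pairwise_disjoint_overrings_localizationAt_diff_top hD)]
  have := Fintype.ofFinite (MaximalSpectrum D)
  simp only [hcard, finsum_eq_sum_of_fintype, Finset.sum_add_distrib, Finset.sum_const,
    Finset.card_univ, Nat.card_eq_fintype_card]
  push_cast
  simp
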